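/- Let $N \ge 2$. Call a non-empty connected open set $\Omega\subset\mathbb{R}^N$ with $C^\infty$ boundary (locally on one side of $\partial\Omega$) a smooth domain, and call it admissible if $\partial\Omega$ is non-empty and bounded. Then to every admissible $\Omega$ one can assign a number $d_0=d_0(\Omega)>0$, depending only on $\Omega$, and for all $p,q$ with $$1<p<\frac{N+3}{N-1},\qquad 1<q<\frac{N+2}{N}$$ there is a constant $c=c(N,p,q)>0$, such that the following holds for every admissible $\Omega$ and every $M>0$. If $u\in C^2(\Omega)$ is a positive solution of $$-\Delta u=|u|^{p-1}u+M|\nabla u|^q\quad\text{in }\Omega,$$ then $u$ attains a maximum on the set $\{z\in\Omega:\operatorname{dist}(z,\partial\Omega)=d_0\}$ (which in particular is non-empty), and $$u(x)\le c\left(\operatorname{dist}(x,\partial\Omega)^{-\frac{2}{p-1}}+\max_{z\in\Omega,\ \operatorname{dist}(z,\partial\Omega)=d_0}u(z)\right)\qquad\text{for all }x\in\Omega.$$ -/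

import Mathlib

/-- A smooth domain of `ℝ^N`: a non-empty connected open set which, near each of its boundary
points, is a strict sublevel set of a `C^∞` function with non-vanishing differential there.
(So it is locally on one side of its boundary, a smooth hypersurface.) -/
structure IsSmoothDomain {N : ℕ} (Ω : Set (EuclideanSpace ℝ (Fin N))) : Prop where
  isOpen : IsOpen Ω
  isConnected : IsConnected Ω
  smooth_boundary : ∀ x ∈ frontier Ω,
    ∃ (U : Set (EuclideanSpace ℝ (Fin N))) (ρ : EuclideanSpace ℝ (Fin N) → ℝ),
      IsOpen U ∧ x ∈ U ∧ ContDiffOn ℝ ((⊤ : ℕ∞) : WithTop ℕ∞) ρ U ∧ fderiv ℝ ρ x ≠ 0 ∧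
        ∀ y ∈ U, y ∈ Ω ↔ ρ y < 0

/-- `u` is a positive (classical, `C²`) solution of `-Δu = |u|^{p-1} u + M |∇u|^q` in the open
set `Ω`. Only the values of `u` on `Ω` matter. -/
structure IsPositiveSolution {N : ℕ} (Ω : Set (EuclideanSpace ℝ (Fin N))) (p q M : ℝ)
    (u : EuclideanSpace ℝ (Fin N) → ℝ) : Prop where
  contDiffOn : ContDiffOn ℝ 2 u Ω
  pos : ∀ x ∈ Ω, 0 < u x
  eqn : ∀ x ∈ Ω,
    -(Laplacian.laplacian u x) = |u x| ^ (p - 1) * u x + M * ‖gradient u x‖ ^ q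

open Filter Topology


/-! The estimate holds without the maximum term: every positive solution satisfies `u x ≤ c *
dist(x, ∂Ω) ^ (-2/(p-1))`, with `c` independent of `Ω`, `M` and `u`. Hence `d₀` may be any value
taken by the distance on `Ω`; the maximum exists by compactness, is positive, and is simply added to
the right-hand side.

The universal bound comes from Bernstein's method applied to `w = log u`. It solves `-Δw = S` with
`S = X + Y + Z`, `X = |∇w|²`, `Y = e^{(p-1)w}`, `Z = M e^{(q-1)w} X^{q/2}`. At an interior maximum
of `φ X`, `φ = (R² - |x - x₀|²)²`, Bochner's formula contains the good term `|D²w|²` and the bad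
terms `(p-1)XY + (q-1)XZ`. The critical point equation controls `D²w` in the direction `∇w`, so the
rest of the trace lies on the `N - 1` orthogonal directions and `|D²w|²` is at least `S²/(N-1)` up
to lower order (`sq_add_sq_le_sum_sq`). Since `4X(Y+Z) ≤ S²`, the good term wins when `(N-1)(p-1) <
4` and `(N-1)(q-1) < 4`; the first is exactly `p < (N+3)/(N-1)`, the second is weaker than `q <
(N+2)/N`. This bounds `S` at the maximum (`logSource_le_at_max`), hence `|∇w| ≤ C/R` on the half
ball. As `M` enters only through `Z ≥ 0`, no constant depends on it.

So `w` oscillates by a bounded amount on the half ball. Touching `w` from below by a paraboloid of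
opening of order `R⁻²` gives a point where `Y ≤ S = -Δw ≤ C R⁻²`, and the oscillation bound carries
this back to the centre (`exp_le_of_logSource`).

Bochner's formula needs three derivatives while `w` is only `C²`. The third derivatives occur only
through `∇Δw = -∇S`, and `S` is `C¹` where `∇w ≠ 0`, so the inequality at the maximum passes to the
limit from mollifications (`weightedBochner_nonpos_of_hasCompactSupport`). -/

/-- The Euclidean space `ℝ^N`. -/
abbrev Euc (N : ℕ) := EuclideanSpace ℝ (Fin N)

/-- The `i`-th partial derivative. -/
noncomputable def pd {N : ℕ} (i : Fin N) (f : Euc N → ℝ) (x : Euc N) : ℝ :=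
  fderiv ℝ f x (EuclideanSpace.single i 1)

/-! ### Calculus of partial derivatives and the second order test. -/

section PartialDerivatives

variable {N : ℕ} {f g : Euc N → ℝ} {x : Euc N} {i j : Fin N}

theorem pd_congr (h : f =ᶠ[𝓝 x] g) : pd i f x = pd i g x := by
  simp only [pd, h.fderiv_eq]

theorem pd_congr_nhds (h : f =ᶠ[𝓝 x] g) : pd i f =ᶠ[𝓝 x] pd i g :=
  h.eventuallyEq_nhds.mono fun _ hy => pd_congr hy

theorem pd_const (c : ℝ) : pd i (fun _ => c) x = 0 := by
  simp [pd]

theorem pd_add (hf : DifferentiableAt ℝ f x) (hg : DifferentiableAt ℝ g x) :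
    pd i (fun y => f y + g y) x = pd i f x + pd i g x := by
  simp [pd, fderiv_fun_add hf hg]

theorem pd_sub (hf : DifferentiableAt ℝ f x) (hg : DifferentiableAt ℝ g x) :
    pd i (fun y => f y - g y) x = pd i f x - pd i g x := by
  simp [pd, fderiv_fun_sub hf hg]

theorem pd_neg : pd i (fun y => -f y) x = -pd i f x := by
  simp [pd]

theorem pd_const_mul (hf : DifferentiableAt ℝ f x) (c : ℝ) :
    pd i (fun y => c * f y) x = c * pd i f x := by
  simp [pd, fderiv_const_mul hf]

theorem pd_mul (hf : DifferentiableAt ℝ f x) (hg : DifferentiableAt ℝ g x) :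
    pd i (fun y => f y * g y) x = pd i f x * g x + f x * pd i g x := by
  simp [pd, fderiv_fun_mul hf hg]; ring

theorem pd_sq (hf : DifferentiableAt ℝ f x) :
    pd i (fun y => f y ^ 2) x = 2 * (f x * pd i f x) := by
  simp only [pow_two]
  rw [pd_mul hf hf]; ring

theorem pd_sum {ι : Type*} {s : Finset ι} {F : ι → Euc N → ℝ}
    (h : ∀ k ∈ s, DifferentiableAt ℝ (F k) x) :
    pd i (fun y => ∑ k ∈ s, F k y) x = ∑ k ∈ s, pd i (F k) x := by
  simp [pd, fderiv_fun_sum h]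

theorem pd_comp {h : ℝ → ℝ} {h' : ℝ} (hh : HasDerivAt h h' (f x)) (hf : DifferentiableAt ℝ f x) :
    pd i (fun y => h (f y)) x = h' * pd i f x := by
  have := (hh.comp_hasFDerivAt x hf.hasFDerivAt).fderiv
  simp only [pd]
  rw [show (fun y => h (f y)) = h ∘ f from rfl, this]
  simp

theorem ContDiffAt.pd {m n : WithTop ℕ∞} (hf : ContDiffAt ℝ n f x) (hmn : m + 1 ≤ n) :
    ContDiffAt ℝ m (pd i f) x :=
  (hf.fderiv_right hmn).clm_apply contDiffAt_const

theorem ContDiff.pd {m n : WithTop ℕ∞} (hf : ContDiff ℝ n f) (hmn : m + 1 ≤ n) :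
    ContDiff ℝ m (pd i f) :=
  (hf.fderiv_right hmn).clm_apply contDiff_const

theorem HasCompactSupport.pd (hf : HasCompactSupport f) : HasCompactSupport (pd i f) :=
  (hf.fderiv (𝕜 := ℝ)).comp_left (g := fun L : Euc N →L[ℝ] ℝ => L (EuclideanSpace.single i 1)) rfl

theorem pd_pd_eq (hf : ContDiffAt ℝ 2 f x) (i j : Fin N) :
    pd i (pd j f) x =
      fderiv ℝ (fderiv ℝ f) x (EuclideanSpace.single i 1) (EuclideanSpace.single j 1) := by
  have h : DifferentiableAt ℝ (fderiv ℝ f) x :=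
    (hf.fderiv_right (m := 1) (by norm_num)).differentiableAt (by norm_num)
  have h1 := h.hasFDerivAt.clm_apply (hasFDerivAt_const (EuclideanSpace.single j (1 : ℝ)) x)
  have h2 : fderiv ℝ (pd j f) x = _ := h1.fderiv
  rw [pd, h2]
  simp

theorem pd_comm (hf : ContDiffAt ℝ 2 f x) (i j : Fin N) :
    pd i (pd j f) x = pd j (pd i f) x := by
  rw [pd_pd_eq hf, pd_pd_eq hf]
  exact hf.isSymmSndFDerivAt (by simp) _ _

theorem laplacian_eq_sum_pd (hf : ContDiffAt ℝ 2 f x) :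
    Laplacian.laplacian f x = ∑ i, pd i (pd i f) x := by
  rw [InnerProductSpace.laplacian_eq_iteratedFDeriv_orthonormalBasis f
    (EuclideanSpace.basisFun (Fin N) ℝ)]
  refine Finset.sum_congr rfl fun i _ => ?_
  rw [pd_pd_eq hf, iteratedFDeriv_two_apply]
  simp

theorem inner_gradient_single (f : Euc N → ℝ) (x : Euc N) (i : Fin N) :
    gradient f x i = pd i f x := by
  have h := inner_gradient_left (𝕜 := ℝ) (f := f) (x := x) (y := EuclideanSpace.single i (1 : ℝ))
  rw [EuclideanSpace.inner_single_right] at h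
  simpa [pd] using h

theorem norm_gradient_sq (f : Euc N → ℝ) (x : Euc N) :
    ‖gradient f x‖ ^ 2 = ∑ i, pd i f x ^ 2 := by
  rw [EuclideanSpace.norm_sq_eq]
  simp [inner_gradient_single]

theorem hasDerivAt_line (hf : DifferentiableAt ℝ f x) (i : Fin N) (t : ℝ) (y : Euc N)
    (hx : y + t • EuclideanSpace.single i (1 : ℝ) = x) :
    HasDerivAt (fun s : ℝ => f (y + s • EuclideanSpace.single i (1 : ℝ))) (pd i f x) t := by
  subst hx
  have h1 : HasDerivAt (fun s : ℝ => y + s • EuclideanSpace.single i (1 : ℝ))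
      (EuclideanSpace.single i (1 : ℝ)) t := by
    simpa using ((hasDerivAt_id t).smul_const (EuclideanSpace.single i (1 : ℝ))).const_add y
  exact hf.hasFDerivAt.comp_hasDerivAt t h1

theorem IsLocalMax.pd_eq_zero (h : IsLocalMax f x) : pd i f x = 0 := by
  simp [pd, h.fderiv_eq_zero]

/-- The second order necessary condition at a local maximum. -/
theorem IsLocalMax.pd_pd_nonpos (h : IsLocalMax f x) (hf : ContDiffAt ℝ 2 f x) (i : Fin N) :
    pd i (pd i f) x ≤ 0 := by
  by_contra! hpos
  set e : Euc N := EuclideanSpace.single i (1 : ℝ)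
  set γ : ℝ → Euc N := fun s => x + s • e
  have hγ0 : γ 0 = x := by simp [γ]
  have hγ : Tendsto γ (𝓝 0) (𝓝 x) := by
    have : Continuous γ := by fun_prop
    simpa [hγ0] using this.tendsto 0
  have hd : ∀ᶠ y in 𝓝 x, DifferentiableAt ℝ f y :=
    (hf.eventually (by simp)).mono fun y hy => hy.differentiableAt (by norm_num)
  have h1 : deriv (fun s => f (γ s)) =ᶠ[𝓝 0] fun s => _root_.pd i f (γ s) :=
    (hγ.eventually hd).mono fun s hs => (hasDerivAt_line hs i s x rfl).deriv
  have hpd : DifferentiableAt ℝ (_root_.pd i f) x :=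
    (hf.pd (m := 1) (by norm_num)).differentiableAt (by norm_num)
  have h2 : deriv (deriv fun s => f (γ s)) 0 = _root_.pd i (_root_.pd i f) x := by
    rw [h1.deriv_eq]
    exact (hasDerivAt_line hpd i 0 x hγ0).deriv
  have h3 : deriv (fun s => f (γ s)) 0 = 0 := by
    rw [h1.eq_of_nhds, hγ0]; exact h.pd_eq_zero
  -- A positive second derivative would make `0` a local minimum along the line as well, so the
  -- restriction would be locally constant and its second derivative zero.
  have hmin := isLocalMin_of_deriv_deriv_pos (h2 ▸ hpos) h3
    (hasDerivAt_line hd.self_of_nhds i 0 x hγ0).continuousAt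
  have hmax : IsLocalMax (fun s => f (γ s)) 0 := by
    have := hγ.eventually h
    simpa [IsLocalMax, IsMaxFilter, hγ0] using this
  have hc : (fun s => f (γ s)) =ᶠ[𝓝 0] fun _ => f (γ 0) := by
    filter_upwards [hmin, hmax] with s hs1 hs2 using le_antisymm hs2 hs1
  have h4 : deriv (deriv fun s => f (γ s)) 0 = 0 := by
    have : deriv (fun s => f (γ s)) =ᶠ[𝓝 0] fun _ => 0 := by
      filter_upwards [hc.eventuallyEq_nhds] with s hs
      rw [hs.deriv_eq]; simp
    rw [this.deriv_eq]; simp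
  linarith [h2 ▸ h4]

end PartialDerivatives

/-! ### Mollification and its commutation with derivatives. -/

section Mollification

open MeasureTheory

variable {N : ℕ} {g : Euc N → ℝ}

/-- Mollification by a normalised bump function. -/
noncomputable def mollify {N : ℕ} (η : ContDiffBump (0 : Euc N)) (g : Euc N → ℝ) : Euc N → ℝ :=
  convolution (η.normed volume) g (ContinuousLinearMap.lsmul ℝ ℝ) volume

theorem mollify_apply (η : ContDiffBump (0 : Euc N)) (g : Euc N → ℝ) (x : Euc N) :
    mollify η g x = ∫ t, η.normed volume t * g (x - t) := by
  simp [mollify, convolution]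

theorem contDiff_mollify (η : ContDiffBump (0 : Euc N)) (hg : Continuous g) (n : ℕ∞) :
    ContDiff ℝ n (mollify η g) :=
  η.hasCompactSupport_normed.contDiff_convolution_left _ η.contDiff_normed hg.locallyIntegrable

theorem pd_mollify (η : ContDiffBump (0 : Euc N)) (hg : ContDiff ℝ 1 g)
    (hgc : HasCompactSupport g) (i : Fin N) : pd i (mollify η g) = mollify η (pd i g) := by
  funext x
  have hη : LocallyIntegrable (η.normed (volume : Measure (Euc N))) volume :=
    η.continuous_normed.locallyIntegrable
  have h := hgc.hasFDerivAt_convolution_right (ContinuousLinearMap.lsmul ℝ ℝ) hη hg x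
  have h2 : fderiv ℝ (mollify η g) x = _ := h.fderiv
  rw [pd, h2, convolution_precompR_apply _ hη (hgc.fderiv ℝ) (hg.continuous_fderiv one_ne_zero)]
  rfl

theorem mollify_sum (η : ContDiffBump (0 : Euc N)) {ι : Type*} (s : Finset ι)
    (F : ι → Euc N → ℝ) (hF : ∀ k ∈ s, Continuous (F k)) (x : Euc N) :
    mollify η (fun y => ∑ k ∈ s, F k y) x = ∑ k ∈ s, mollify η (F k) x := by
  simp only [mollify_apply, Finset.mul_sum]
  refine integral_finsetSum _ fun k hk => ?_
  refine Continuous.integrable_of_hasCompactSupport ?_ ?_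
  · exact η.continuous_normed.mul ((hF k hk).comp (by fun_prop))
  · exact η.hasCompactSupport_normed.mul_right

theorem mollify_congr (η : ContDiffBump (0 : Euc N)) {f g : Euc N → ℝ} {x : Euc N}
    (h : ∀ y ∈ Metric.ball x η.rOut, f y = g y) : mollify η f x = mollify η g x := by
  simp only [mollify_apply]
  refine integral_congr_ae (Eventually.of_forall fun t => ?_)
  by_cases ht : t ∈ Metric.ball (0 : Euc N) η.rOut
  · have : x - t ∈ Metric.ball x η.rOut := by
      simpa [dist_eq_norm] using ht
    simp [h _ this]
  · have : η.normed volume t = 0 := by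
      rw [← Function.notMem_support, η.support_normed_eq]; exact ht
    simp [this]

theorem tendsto_mollify {ι : Type*} {η : ι → ContDiffBump (0 : Euc N)} {l : Filter ι}
    (hη : Tendsto (fun n => (η n).rOut) l (𝓝 0)) (hg : Continuous g) {y : ι → Euc N} {x : Euc N}
    (hy : Tendsto y l (𝓝 x)) : Tendsto (fun n => mollify (η n) g (y n)) l (𝓝 (g x)) :=
  ContDiffBump.convolution_tendsto_right hη
    (Eventually.of_forall fun _ => hg.aestronglyMeasurable)
    (hg.continuousAt.tendsto.comp tendsto_snd) hy

end Mollification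

/-! ### Bochner's formula for `C³` functions. -/

section Bochner

variable {N : ℕ} {f g v w S φ : Euc N → ℝ} {x x₁ : Euc N}

theorem differentiable_coord (i : Fin N) (x : Euc N) :
    DifferentiableAt ℝ (fun y : Euc N => y i) x :=
  (EuclideanSpace.proj (𝕜 := ℝ) i).differentiableAt

theorem pd_coord (i j : Fin N) (x : Euc N) :
    pd i (fun y : Euc N => y j) x = if j = i then 1 else 0 := by
  have : fderiv ℝ (fun y : Euc N => y j) x = EuclideanSpace.proj (𝕜 := ℝ) j :=
    (EuclideanSpace.proj (𝕜 := ℝ) j).fderiv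
  rw [pd, this]
  simp [EuclideanSpace.proj]

theorem pd_norm_sub_sq (x₁ : Euc N) (i : Fin N) :
    pd i (fun x => ‖x - x₁‖ ^ 2) = fun x => 2 * (x i - x₁ i) := by
  funext x
  have h : (fun x : Euc N => ‖x - x₁‖ ^ 2) = fun x => ∑ j, (x j - x₁ j) ^ 2 := by
    funext x; rw [EuclideanSpace.norm_sq_eq]; simp
  have hd : ∀ j, DifferentiableAt ℝ (fun y : Euc N => y j - x₁ j) x := fun j =>
    (differentiable_coord j x).sub_const _
  rw [h, pd_sum fun j _ => (hd j).fun_pow 2]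
  have : ∀ j, pd i (fun y : Euc N => (y j - x₁ j) ^ 2) x =
      if j = i then 2 * (x j - x₁ j) else 0 := fun j => by
    rw [pd_sq (hd j), pd_sub (differentiable_coord j x) (differentiableAt_const _), pd_coord,
      pd_const]
    split_ifs <;> ring
  simp [this]

theorem pd_pd_norm_sub_sq (x₁ x : Euc N) (i : Fin N) :
    pd i (pd i fun x => ‖x - x₁‖ ^ 2) x = 2 := by
  rw [pd_norm_sub_sq, pd_const_mul ((differentiable_coord i x).sub_const _),
    pd_sub (differentiable_coord i x) (differentiableAt_const _), pd_coord, pd_const]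
  simp

theorem contDiff_norm_sub_sq (x₁ : Euc N) {n : WithTop ℕ∞} :
    ContDiff ℝ n fun x => ‖x - x₁‖ ^ 2 :=
  (contDiff_id.sub contDiff_const).norm_sq ℝ

theorem pd_pd_sub (hf : ContDiffAt ℝ 2 f x) (hg : ContDiffAt ℝ 2 g x) (i : Fin N) :
    pd i (pd i fun y => f y - g y) x = pd i (pd i f) x - pd i (pd i g) x := by
  have h : pd i (fun y => f y - g y) =ᶠ[𝓝 x] fun y => pd i f y - pd i g y := by
    filter_upwards [hf.eventually (by simp), hg.eventually (by simp)] with y h1 h2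
    exact pd_sub (h1.differentiableAt (by norm_num)) (h2.differentiableAt (by norm_num))
  have hf1 : ContDiffAt ℝ 1 (pd i f) x := hf.pd (by norm_num)
  have hg1 : ContDiffAt ℝ 1 (pd i g) x := hg.pd (by norm_num)
  rw [pd_congr h, pd_sub (hf1.differentiableAt (by norm_num)) (hg1.differentiableAt (by norm_num))]

theorem pd_pd_mul_norm_sub_sq (δ : ℝ) (x₁ x : Euc N) (i : Fin N) :
    pd i (pd i fun y => δ * ‖y - x₁‖ ^ 2) x = δ * 2 := by
  have hd : ContDiff ℝ 2 fun y => ‖y - x₁‖ ^ 2 := contDiff_norm_sub_sq x₁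
  have hd1 : ContDiff ℝ 1 (pd i fun y => ‖y - x₁‖ ^ 2) := hd.pd (by norm_num)
  have : pd i (fun y => δ * ‖y - x₁‖ ^ 2) = fun y => δ * pd i (fun y => ‖y - x₁‖ ^ 2) y :=
    funext fun y => pd_const_mul (hd.differentiable (by norm_num) y) δ
  rw [this, pd_const_mul (hd1.differentiable (by norm_num) x), pd_pd_norm_sub_sq]

theorem pd_pd_mul (hf : ContDiff ℝ 2 f) (hg : ContDiff ℝ 2 g) (i : Fin N) (x : Euc N) :
    pd i (pd i fun y => f y * g y) x =
      pd i (pd i f) x * g x + 2 * (pd i f x * pd i g x) + f x * pd i (pd i g) x := by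
  have hfd := hf.differentiable (by norm_num)
  have hgd := hg.differentiable (by norm_num)
  have h : pd i (fun y => f y * g y) = fun y => pd i f y * g y + f y * pd i g y := funext fun y =>
    pd_mul (hfd y) (hgd y)
  have hf1 : ContDiff ℝ 1 (pd i f) := hf.pd (by norm_num)
  have hg1 : ContDiff ℝ 1 (pd i g) := hg.pd (by norm_num)
  have hf1d := hf1.differentiable (by norm_num)
  have hg1d := hg1.differentiable (by norm_num)
  rw [h, pd_add ((hf1d x).fun_mul (hgd x)) ((hfd x).fun_mul (hg1d x)), pd_mul (hf1d x) (hgd x),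
    pd_mul (hfd x) (hg1d x)]
  ring

theorem pd_sum_sq (i : Fin N) (hv : ∀ j, DifferentiableAt ℝ (pd j v) x) :
    pd i (fun y => ∑ j, pd j v y ^ 2) x = 2 * ∑ j, pd j v x * pd i (pd j v) x := by
  rw [pd_sum fun j _ => (hv j).fun_pow 2, Finset.mul_sum]
  exact Finset.sum_congr rfl fun j _ => pd_sq (hv j)

theorem pd_pd_sum_sq (hv : ContDiff ℝ 3 v) (i : Fin N) (x : Euc N) :
    pd i (pd i fun y => ∑ j, pd j v y ^ 2) x =
      2 * ∑ j, (pd i (pd j v) x ^ 2 + pd j v x * pd i (pd i (pd j v)) x) := by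
  have h1 : ∀ j, ContDiff ℝ 2 (pd j v) := fun j => hv.pd (by norm_num)
  have h1d : ∀ j, Differentiable ℝ (pd j v) := fun j => (h1 j).differentiable (by norm_num)
  have h2 : ∀ j, ContDiff ℝ 1 (pd i (pd j v)) := fun j => (h1 j).pd (by norm_num)
  have h2d : ∀ j, Differentiable ℝ (pd i (pd j v)) := fun j => (h2 j).differentiable (by norm_num)
  have h : pd i (fun y => ∑ j, pd j v y ^ 2) =
      fun y => 2 * ∑ j, pd j v y * pd i (pd j v) y := funext fun y =>
    pd_sum_sq i fun j => h1d j y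
  rw [h, pd_const_mul (DifferentiableAt.fun_sum fun j _ => (h1d j x).fun_mul (h2d j x)),
    pd_sum fun j _ => (h1d j x).fun_mul (h2d j x)]
  congr 1
  refine Finset.sum_congr rfl fun j _ => ?_
  rw [pd_mul (h1d j x) (h2d j x)]; ring

theorem sum_pd_pd_pd (hv : ContDiff ℝ 3 v) (j : Fin N) (x : Euc N) :
    ∑ i, pd i (pd i (pd j v)) x = pd j (fun y => ∑ i, pd i (pd i v) y) x := by
  have h1 : ∀ i, ContDiff ℝ 2 (pd i v) := fun i => hv.pd (by norm_num)
  have h2 : ∀ i, ContDiff ℝ 1 (pd i (pd i v)) := fun i => (h1 i).pd (by norm_num)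
  rw [pd_sum fun i _ => (h2 i).differentiable (by norm_num) x]
  refine Finset.sum_congr rfl fun i _ => ?_
  have h : pd i (pd j v) = pd j (pd i v) := funext fun y =>
    pd_comm (hv.of_le (by norm_num)).contDiffAt i j
  rw [h, pd_comm (h1 i).contDiffAt]

/-- The Laplacian of `φ |∇v|²`, with the third order terms replaced by `b`. -/
noncomputable def weightedBochner (φ v : Euc N → ℝ) (b : Fin N → ℝ) (x : Euc N) : ℝ :=
  ∑ i, (pd i (pd i φ) x * ∑ j, pd j v x ^ 2 +
    4 * (pd i φ x * ∑ j, pd j v x * pd i (pd j v) x) +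
    2 * (φ x * ∑ j, pd i (pd j v) x ^ 2)) + 2 * (φ x * ∑ j, pd j v x * b j)

/-- Bochner's formula. -/
theorem sum_pd_pd_mul_sum_sq (hφ : ContDiff ℝ 2 φ) (hv : ContDiff ℝ 3 v) (x : Euc N) :
    ∑ i, pd i (pd i fun y => φ y * ∑ j, pd j v y ^ 2) x =
      weightedBochner φ v (fun j => pd j (fun y => ∑ i, pd i (pd i v) y) x) x := by
  have h1 : ∀ j, ContDiff ℝ 2 (pd j v) := fun j => hv.pd (by norm_num)
  have hX : ContDiff ℝ 2 fun y => ∑ j, pd j v y ^ 2 := ContDiff.sum fun j _ => (h1 j).pow 2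
  have h1d : ∀ j, DifferentiableAt ℝ (pd j v) x := fun j =>
    (h1 j).differentiable (by norm_num) x
  have h : ∀ i, pd i (pd i fun y => φ y * ∑ j, pd j v y ^ 2) x =
      (pd i (pd i φ) x * ∑ j, pd j v x ^ 2 +
        4 * (pd i φ x * ∑ j, pd j v x * pd i (pd j v) x) +
        2 * (φ x * ∑ j, pd i (pd j v) x ^ 2)) +
      2 * (φ x * ∑ j, pd j v x * pd i (pd i (pd j v)) x) := fun i => by
    rw [pd_pd_mul hφ hX, pd_sum_sq i h1d, pd_pd_sum_sq hv, Finset.sum_add_distrib]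
    ring
  rw [Finset.sum_congr rfl fun i _ => h i, Finset.sum_add_distrib, weightedBochner]
  congr 1
  simp only [← sum_pd_pd_pd hv, ← Finset.mul_sum]
  rw [Finset.sum_comm]
  simp only [Finset.mul_sum]

/-- The Laplacian is nonpositive at a maximum, and the penalty `δ |y - x₁|²` has Laplacian `2Nδ`.
The penalty is what keeps maxima of mollified functions near `x₁`. -/
theorem weightedBochner_le_of_isLocalMax {δ : ℝ} (hφ : ContDiff ℝ 2 φ) (hv : ContDiff ℝ 3 v)
    (h : IsLocalMax (fun y => φ y * (∑ j, pd j v y ^ 2) - δ * ‖y - x₁‖ ^ 2) x) :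
    weightedBochner φ v (fun j => pd j (fun y => ∑ i, pd i (pd i v) y) x) x ≤ N * (δ * 2) := by
  have h1 : ∀ j, ContDiff ℝ 2 (pd j v) := fun j => hv.pd (by norm_num)
  have hX : ContDiff ℝ 2 fun y => φ y * ∑ j, pd j v y ^ 2 :=
    hφ.mul (ContDiff.sum fun j _ => (h1 j).pow 2)
  have hq : ContDiff ℝ 2 fun y => δ * ‖y - x₁‖ ^ 2 := contDiff_const.mul (contDiff_norm_sub_sq x₁)
  rw [← sum_pd_pd_mul_sum_sq hφ hv]
  calc ∑ i, pd i (pd i fun y => φ y * ∑ j, pd j v y ^ 2) x ≤ ∑ _i : Fin N, δ * 2 := by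
        refine Finset.sum_le_sum fun i _ => ?_
        have := h.pd_pd_nonpos (hX.sub hq).contDiffAt i
        rw [pd_pd_sub hX.contDiffAt hq.contDiffAt, pd_pd_mul_norm_sub_sq] at this
        linarith
    _ = N * (δ * 2) := by simp

end Bochner

/-! ### Bochner's inequality at a maximum for `C²` functions with `C¹` Laplacian. -/

section BochnerLimit

variable {N : ℕ} {w S φ : Euc N → ℝ} {x₁ : Euc N}

theorem exists_contDiffBump_seq (N : ℕ) :
    ∃ η : ℕ → ContDiffBump (0 : Euc N), Tendsto (fun n => (η n).rOut) atTop (𝓝 0) := by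
  have hpos : ∀ n : ℕ, (0 : ℝ) < 1 / (n + 1) := fun n => by positivity
  refine ⟨fun n => ⟨1 / (n + 1), 2 * (1 / (n + 1)), hpos n, by linarith [hpos n]⟩, ?_⟩
  simpa using (tendsto_one_div_add_atTop_nhds_zero_nat (𝕜 := ℝ)).const_mul 2

/-- Bochner's inequality at a local maximum of `φ |∇w|²` for `C²` functions `w` whose Laplacian is
`C¹` near the maximum. -/
theorem weightedBochner_nonpos_of_hasCompactSupport (hw : ContDiff ℝ 2 w)
    (hwc : HasCompactSupport w) (hS : ContDiff ℝ 1 S) (hSc : HasCompactSupport S)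
    (hφ : ContDiff ℝ 2 φ) (heq : ∀ᶠ x in 𝓝 x₁, ∑ i, pd i (pd i w) x = S x)
    (hmax : IsLocalMax (fun x => φ x * ∑ j, pd j w x ^ 2) x₁) :
    weightedBochner φ w (fun j => pd j S x₁) x₁ ≤ 0 := by
  have hw1 : ∀ i, ContDiff ℝ 1 (pd i w) := fun i => hw.pd (by norm_num)
  have hw2 : ∀ i j, Continuous (pd i (pd j w)) := fun i j =>
    (ContDiff.pd (m := 0) (hw1 j) (by norm_num)).continuous
  have hS1 : ∀ i, Continuous (pd i S) := fun i =>
    (ContDiff.pd (m := 0) hS (by norm_num)).continuous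
  -- The penalty with weight `δ` turns `x₁` into a strict maximum; afterwards `δ → 0`.
  suffices key : ∀ δ > 0, weightedBochner φ w (fun j => pd j S x₁) x₁ ≤ N * (δ * 2) by
    refine le_of_forall_pos_le_add fun ε hε => ?_
    refine (key (ε / (2 * N + 1)) (by positivity)).trans ?_
    rw [zero_add, div_mul_eq_mul_div, mul_div_assoc', div_le_iff₀ (by positivity)]
    nlinarith
  intro δ hδ
  obtain ⟨r, hr, hball⟩ := Metric.eventually_nhds_iff_ball.1 (heq.and hmax)
  set K := Metric.closedBall x₁ (r / 2) with hK
  obtain ⟨η, hη⟩ := exists_contDiffBump_seq N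
  set v : ℕ → Euc N → ℝ := fun n => mollify (η n) w with hv
  have hvs : ∀ n, ContDiff ℝ 3 (v n) := fun n => contDiff_mollify (η n) hw.continuous 3
  have hv1 : ∀ n i, pd i (v n) = mollify (η n) (pd i w) := fun n i =>
    pd_mollify _ (hw.of_le (by norm_num)) hwc i
  have hv2 : ∀ n i j, pd i (pd j (v n)) = mollify (η n) (pd i (pd j w)) := fun n i j => by
    rw [hv1, pd_mollify _ (hw1 j) hwc.pd]
  set G : ℕ → Euc N → ℝ := fun n y => φ y * (∑ j, pd j (v n) y ^ 2) - δ * ‖y - x₁‖ ^ 2 with hG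
  have hGc : ∀ n, Continuous (G n) := fun n => by
    have : ∀ j, Continuous (pd j (v n)) := fun j =>
      (ContDiff.pd (m := 2) (hvs n) (by norm_num)).continuous
    have := hφ.continuous
    fun_prop
  have hex : ∀ n, ∃ y ∈ K, IsMaxOn (G n) K y := fun n =>
    (isCompact_closedBall x₁ (r / 2)).exists_isMaxOn
      (Metric.nonempty_closedBall.2 (by positivity)) (hGc n).continuousOn
  choose y hyK hymax using hex
  -- Along an ultrafilter the maximum points `y n` converge in the compact ball, with no subsequence
  -- to extract.
  let 𝒰 : Ultrafilter ℕ := Ultrafilter.of atTop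
  have h𝒰 : (𝒰 : Filter ℕ) ≤ atTop := Ultrafilter.of_le _
  have hη' : Tendsto (fun n => (η n).rOut) 𝒰 (𝓝 0) := hη.mono_left h𝒰
  obtain ⟨z, hzK, hz⟩ := (isCompact_closedBall x₁ (r / 2)).ultrafilter_le_nhds (𝒰.map y)
    (le_principal_iff.2 (Eventually.of_forall hyK : ∀ᶠ n in (𝒰 : Filter ℕ), y n ∈ K))
  have hz' : Tendsto y 𝒰 (𝓝 z) := hz
  have hGlim : ∀ {p : ℕ → Euc N} {p₀ : Euc N}, Tendsto p 𝒰 (𝓝 p₀) →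
      Tendsto (fun n => G n (p n)) 𝒰
        (𝓝 (φ p₀ * (∑ j, pd j w p₀ ^ 2) - δ * ‖p₀ - x₁‖ ^ 2)) := fun {p p₀} hp => by
    simp only [hG, hv1]
    have h2 : Tendsto (fun n => ‖p n - x₁‖ ^ 2) 𝒰 (𝓝 (‖p₀ - x₁‖ ^ 2)) :=
      ((hp.sub_const x₁).norm).pow 2
    exact (((hφ.continuous.tendsto p₀).comp hp).mul (tendsto_finsetSum _ fun j _ =>
      (tendsto_mollify hη' (hw1 j).continuous hp).pow 2)).sub (h2.const_mul δ)
  -- In the limit the penalised function at `z` is at least its value at `x₁`, whereas the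
  -- unpenalised one is at most that value; hence `δ |z - x₁|² ≤ 0`.
  have hzx : z = x₁ := by
    have h1 := le_of_tendsto_of_tendsto' (hGlim (tendsto_const_nhds (x := x₁))) (hGlim hz')
      fun n => hymax n (Metric.mem_closedBall_self (by positivity))
    have h2 := (hball z (Metric.closedBall_subset_ball (by linarith) hzK)).2
    have h3 : δ * ‖z - x₁‖ ^ 2 ≤ 0 := by
      simp only [sub_self, norm_zero] at h1
      linarith
    have h4 : ‖z - x₁‖ ^ 2 ≤ 0 := nonpos_of_mul_nonpos_right h3 hδ
    exact sub_eq_zero.1 (norm_eq_zero.1 (pow_eq_zero_iff two_ne_zero |>.1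
      (le_antisymm h4 (sq_nonneg _))))
  subst hzx
  have hev : ∀ᶠ n in (𝒰 : Filter ℕ), weightedBochner φ (v n)
      (fun j => mollify (η n) (pd j S) (y n)) (y n) ≤ N * (δ * 2) := by
    filter_upwards [hz'.eventually (Metric.ball_mem_nhds z (by positivity : 0 < r / 2)),
      hη'.eventually (gt_mem_nhds (by positivity : 0 < r / 2))] with n hn hηn
    have hloc : IsLocalMax (G n) (y n) :=
      (hymax n).isLocalMax (mem_of_superset (Metric.isOpen_ball.mem_nhds hn)
        Metric.ball_subset_closedBall)
    have := weightedBochner_le_of_isLocalMax hφ (hvs n) hloc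
    convert this using 3 with j
    -- Both `y n` and the mollification radius are within `r / 2`, so only values in the ball of
    -- radius `r`, where the equation holds, are averaged.
    have hL : (fun x => ∑ i, pd i (pd i (v n)) x) =ᶠ[𝓝 (y n)] mollify (η n) S := by
      filter_upwards [Metric.isOpen_ball.mem_nhds hn] with x hx
      simp only [hv2]
      rw [← mollify_sum _ _ _ fun i _ => hw2 i i]
      refine mollify_congr _ fun p hp => (hball p ?_).1
      rw [Metric.mem_ball] at hx hp ⊢
      linarith [dist_triangle p x z]
    rw [pd_congr hL, pd_mollify _ hS hSc]
  refine le_of_tendsto ?_ hev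
  have t1 : ∀ j, Tendsto (fun n => pd j (v n) (y n)) 𝒰 (𝓝 (pd j w z)) := fun j => by
    simp only [hv1]; exact tendsto_mollify hη' (hw1 j).continuous hz'
  have t2 : ∀ i j, Tendsto (fun n => pd i (pd j (v n)) (y n)) 𝒰 (𝓝 (pd i (pd j w) z)) :=
    fun i j => by simp only [hv2]; exact tendsto_mollify hη' (hw2 i j) hz'
  have t3 : ∀ j, Tendsto (fun n => mollify (η n) (pd j S) (y n)) 𝒰 (𝓝 (pd j S z)) := fun j =>
    tendsto_mollify hη' (hS1 j) hz'
  have hφ1 : ∀ i, ContDiff ℝ 1 (pd i φ) := fun i => hφ.pd (by norm_num)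
  have s0 : Tendsto (fun n => φ (y n)) 𝒰 (𝓝 (φ z)) := (hφ.continuous.tendsto z).comp hz'
  have s1 : ∀ i, Tendsto (fun n => pd i φ (y n)) 𝒰 (𝓝 (pd i φ z)) := fun i =>
    ((hφ1 i).continuous.tendsto z).comp hz'
  have s2 : ∀ i, Tendsto (fun n => pd i (pd i φ) (y n)) 𝒰 (𝓝 (pd i (pd i φ) z)) := fun i =>
    ((ContDiff.pd (m := 0) (hφ1 i) (by norm_num)).continuous.tendsto z).comp hz'
  refine Tendsto.add (tendsto_finsetSum _ fun i _ => Tendsto.add (Tendsto.add ?_ ?_) ?_) ?_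
  · exact (s2 i).mul (tendsto_finsetSum _ fun j _ => (t1 j).pow 2)
  · exact ((s1 i).mul (tendsto_finsetSum _ fun j _ => (t1 j).mul (t2 i j))).const_mul 4
  · exact (s0.mul (tendsto_finsetSum _ fun j _ => (t2 i j).pow 2)).const_mul 2
  · exact (s0.mul (tendsto_finsetSum _ fun j _ => (t1 j).mul (t3 j))).const_mul 2

theorem weightedBochner_congr {w' : Euc N → ℝ} (b : Fin N → ℝ) (h : w =ᶠ[𝓝 x₁] w') :
    weightedBochner φ w b x₁ = weightedBochner φ w' b x₁ := by
  have h1 : ∀ j, pd j w x₁ = pd j w' x₁ := fun j => pd_congr h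
  have h2 : ∀ i j, pd i (pd j w) x₁ = pd i (pd j w') x₁ := fun i j => pd_congr (pd_congr_nhds h)
  simp only [weightedBochner, h1, h2]

/-- Multiplication by a bump function equal to `1` near `x`. It reduces the local inequality to
globally smooth, compactly supported data, since only germs at the point matter. -/
theorem exists_contDiff_hasCompactSupport_eventuallyEq {f : Euc N → ℝ} {x : Euc N} {n : ℕ}
    (hf : ContDiffAt ℝ n f x) :
    ∃ g : Euc N → ℝ, ContDiff ℝ n g ∧ HasCompactSupport g ∧ g =ᶠ[𝓝 x] f := by
  obtain ⟨r, hr, hball⟩ := Metric.eventually_nhds_iff_ball.1 (hf.eventually (by simp))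
  let χ : ContDiffBump x := ⟨r / 3, r / 2, by positivity, by linarith⟩
  have hχ : ContDiff ℝ n χ := χ.contDiff
  refine ⟨fun y => χ y * f y, ?_, χ.hasCompactSupport.mul_right, ?_⟩
  · rw [contDiff_iff_contDiffAt]
    intro y
    by_cases hy : y ∈ Metric.ball x r
    · exact hχ.contDiffAt.mul (hball y hy)
    · have hy' : y ∉ tsupport χ := fun h => hy (by
        rw [χ.tsupport_eq] at h
        exact Metric.closedBall_subset_ball (by change r / 2 < r; linarith) h)
      have h0 : (fun y => χ y * f y) =ᶠ[𝓝 y] fun _ => 0 := by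
        filter_upwards [(isClosed_tsupport χ).isOpen_compl.mem_nhds hy'] with p hp
        rw [image_eq_zero_of_notMem_tsupport hp, zero_mul]
      exact contDiffAt_const.congr_of_eventuallyEq h0
  · filter_upwards [χ.eventuallyEq_one] with y hy
    simp [hy]

/-- Bochner's inequality at a local maximum of `φ |∇w|²`, local version. -/
theorem weightedBochner_nonpos_of_isLocalMax (hw : ContDiffAt ℝ 2 w x₁) (hS : ContDiffAt ℝ 1 S x₁)
    (hφ : ContDiff ℝ 2 φ) (heq : ∀ᶠ x in 𝓝 x₁, ∑ i, pd i (pd i w) x = S x)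
    (hmax : IsLocalMax (fun x => φ x * ∑ j, pd j w x ^ 2) x₁) :
    weightedBochner φ w (fun j => pd j S x₁) x₁ ≤ 0 := by
  obtain ⟨w', hw', hwc, hww⟩ := exists_contDiff_hasCompactSupport_eventuallyEq (n := 2) hw
  obtain ⟨S', hS', hSc, hSS⟩ := exists_contDiff_hasCompactSupport_eventuallyEq (n := 1) hS
  rw [← weightedBochner_congr _ hww]
  have : (fun j => pd j S x₁) = fun j => pd j S' x₁ := funext fun j => (pd_congr hSS).symm
  rw [this]
  have h1 : ∀ j, pd j w' =ᶠ[𝓝 x₁] pd j w := fun j => pd_congr_nhds hww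
  have h1' := eventually_all.2 h1
  have h2' := eventually_all.2 fun j => pd_congr_nhds (i := j) (h1 j)
  refine weightedBochner_nonpos_of_hasCompactSupport hw' hwc hS' hSc hφ ?_ ?_
  · filter_upwards [heq, hSS, h2'] with x hx1 hx2 hx3
    rw [hx2, ← hx1]
    exact Finset.sum_congr rfl fun i _ => hx3 i
  · refine hmax.congr ?_
    filter_upwards [h1'] with x hx
    simp only [hx]

end BochnerLimit

/-! ### Algebraic inequalities for the Bernstein argument. -/

section Algebra

/-- Lower bound for the norm of the Hessian in terms of its trace `T` and of its value `a` in the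
direction `ξ`. -/
theorem sq_add_sq_le_sum_sq {N : ℕ} (hN : 2 ≤ N) (H : Fin N → Fin N → ℝ) (ξ : Fin N → ℝ) (a : ℝ)
    (hξ : 0 < ∑ i, ξ i ^ 2) (ha : ∑ i, ξ i * ∑ j, ξ j * H i j = a * ∑ i, ξ i ^ 2) :
    a ^ 2 + (∑ i, H i i - a) ^ 2 / (N - 1) ≤ ∑ i, ∑ j, H i j ^ 2 := by
  set X := ∑ i, ξ i ^ 2 with hX
  set T := ∑ i, H i i with hT
  have hn : (0 : ℝ) < N - 1 := by
    have : (2 : ℝ) ≤ N := by exact_mod_cast hN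
    linarith
  -- Among the matrices `α I + β ξ ⊗ ξ`, the one closest to `H` equals `a` in the direction `ξ` and
  -- shares the remaining trace equally among the `N - 1` orthogonal directions. The claim is that
  -- its distance to `H` has nonnegative square.
  set α := (T - a) / (N - 1) with hα
  set β := (a - α) / X with hβ
  have hβX : β * X = a - α := div_mul_cancel₀ _ hξ.ne'
  have hαn : α * (N - 1) = T - a := div_mul_cancel₀ _ hn.ne'
  have h0 : 0 ≤ ∑ i, ∑ j, (H i j - α * (if i = j then 1 else 0) - β * (ξ i * ξ j)) ^ 2 := by
    positivity
  have h1 : ∑ i, ∑ j, (H i j - α * (if i = j then 1 else 0) - β * (ξ i * ξ j)) ^ 2 =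
      (∑ i, ∑ j, H i j ^ 2) - 2 * α * T - 2 * β * (a * X) + α ^ 2 * N + 2 * α * (β * X) +
        (β * X) ^ 2 := by
    have e : ∀ i j, (H i j - α * (if i = j then 1 else 0) - β * (ξ i * ξ j)) ^ 2 =
        H i j ^ 2 + (if i = j then α ^ 2 - 2 * α * H i j + 2 * α * β * (ξ i * ξ j) else 0) -
          2 * β * (ξ i * (ξ j * H i j)) + β ^ 2 * (ξ i ^ 2 * ξ j ^ 2) := fun i j => by
      split_ifs <;> ring
    simp only [e, Finset.sum_add_distrib, Finset.sum_sub_distrib, ← Finset.mul_sum,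
      Finset.sum_ite_eq, Finset.mem_univ, if_true]
    rw [ha, ← Finset.sum_mul, ← hX, ← hT]
    have : ∑ i, ξ i * ξ i = X := Finset.sum_congr rfl fun i _ => (pow_two _).symm
    simp [this]
    ring
  have h2 : (T - a) ^ 2 / (N - 1) = α * (T - a) := by rw [hα]; ring
  have h3 : β * (a * X) = a * (a - α) := by rw [← hβX]; ring
  rw [h1, hβX, mul_assoc 2 β, h3] at h0
  rw [h2]
  have h4 : α ^ 2 * N = α * (T - a) + α ^ 2 := by linear_combination α * hαn
  linarith

/-- The scalar inequality closing the Bernstein argument; `s = √S`. -/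
theorem le_of_mul_sq_le {κ A B τ s : ℝ} (hκ : 0 < κ) (hA : 0 ≤ A) (hB : 0 ≤ B) (hτ : 0 ≤ τ)
    (h : κ * s ^ 2 ≤ A * τ * s + B * τ ^ 2) : s ≤ ((A + B) / κ + 1) * τ := by
  by_contra! hs
  have hAB : 0 ≤ (A + B) / κ := by positivity
  -- The summand `1` in the constant gives `τ ≤ s`, so `B τ² ≤ B τ s` and a factor `s` cancels.
  have h1 : τ ≤ s := by nlinarith
  have hs0 : 0 < s := lt_of_le_of_lt (by positivity) hs
  have h2 : κ * s ^ 2 ≤ (A + B) * τ * s := by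
    nlinarith [mul_nonneg (mul_nonneg hB hτ) (sub_nonneg.2 h1)]
  have h3 : κ * s ≤ (A + B) * τ := by
    refine le_of_mul_le_mul_right ?_ hs0
    nlinarith
  have h4 : κ * (((A + B) / κ + 1) * τ) = (A + B) * τ + κ * τ := by field_simp
  have h5 := mul_lt_mul_of_pos_left hs hκ
  nlinarith [mul_nonneg hκ.le hτ]

/-- The Bochner inequality at the maximum point, divided by `2φ` and reduced to numbers: `n = N -
1`, `h = |D²w|²`, `g = ∇w · ∇log φ`, `a` is the second derivative in the direction `∇w`, `D - G` is
`Δφ/(2φ) - |∇φ|²/φ²`, and `τ = R/ψ` is the scale. After the quadratic terms in `S` are compared,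
everything containing `g`, `D` or `G` is of lower order: at most `τ S^{3/2}` or `τ² S` up to
constants. -/
theorem bernstein_scalar {n N p q θ X Y Z S h a g τ D G : ℝ} (hn : 1 ≤ n) (hN : 0 ≤ N)
    (hp : n * (p - 1) ≤ 4 * θ) (hq1 : 1 < q) (hq : n * (q - 1) ≤ 4 * θ) (hθ : θ < 1)
    (hX : 0 ≤ X) (hY : 0 ≤ Y) (hZ : 0 ≤ Z) (hS : S = X + Y + Z) (ha : a = -g / 2) (hτ : 0 ≤ τ)
    (hg : g ^ 2 ≤ 16 * τ ^ 2 * X) (hD : -(2 * N * τ ^ 2) ≤ D) (hG : G ≤ 16 * τ ^ 2)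
    (hh : a ^ 2 + (-S - a) ^ 2 / n ≤ h)
    (hmain : D * X - G * X + h + (g * X + q / 2 * Z * g - (p - 1) * (X * Y) - (q - 1) * (X * Z)) ≤ 0) :
    S ≤ (((8 + 2 * q + (16 + 2 * N)) / ((1 - θ) / n) + 1) * τ) ^ 2 := by
  have hn0 : 0 < n := by linarith
  have hS0 : 0 ≤ S := by rw [hS]; positivity
  set s := √S with hs
  have hsS : s ^ 2 = S := Real.sq_sqrt hS0
  have hs0 : 0 ≤ s := Real.sqrt_nonneg _
  have hXS : X ≤ S := by linarith
  have hZS : Z ≤ S := by linarith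
  have hgabs : |g| ≤ 4 * τ * s := by
    refine abs_le_of_sq_le_sq ?_ (by positivity)
    have : 16 * τ ^ 2 * X ≤ 16 * τ ^ 2 * S := by gcongr
    calc g ^ 2 ≤ 16 * τ ^ 2 * S := hg.trans this
      _ = (4 * τ * s) ^ 2 := by rw [mul_pow, mul_pow, hsS]; ring
  -- Here the exponent ranges enter: `4X(Y+Z) ≤ S²` absorbs both bad terms into `θ S²/n`, and `θ <
  -- 1` leaves a positive multiple of `S²`.
  have hquad : (1 - θ) / n * S ^ 2 ≤ S ^ 2 / n - (p - 1) * (X * Y) - (q - 1) * (X * Z) := by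
    have h1 : n * (p - 1) * (X * Y) ≤ 4 * θ * (X * Y) := by gcongr
    have h2 : n * (q - 1) * (X * Z) ≤ 4 * θ * (X * Z) := by gcongr
    have hθ0 : 0 ≤ θ := by nlinarith
    have h3 : 4 * (X * (Y + Z)) ≤ S ^ 2 := by rw [hS]; nlinarith [sq_nonneg (X - (Y + Z))]
    have h4 : θ * (4 * (X * (Y + Z))) ≤ θ * S ^ 2 := by gcongr
    rw [div_mul_eq_mul_div, div_le_iff₀ hn0, sub_mul, sub_mul, sub_mul, div_mul_cancel₀ _ hn0.ne']
    linarith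
  have hhess : S ^ 2 / n - g * S / n ≤ h := by
    refine le_trans ?_ hh
    have : S ^ 2 / n - g * S / n + (a ^ 2 + a ^ 2 / n) = a ^ 2 + (-S - a) ^ 2 / n := by
      rw [ha]; field_simp; ring
    have h' : 0 ≤ a ^ 2 + a ^ 2 / n := by positivity
    linarith
  have hgS : g * S / n ≤ |g| * S := by
    rw [div_le_iff₀ hn0]
    calc g * S ≤ |g| * S := by gcongr; exact le_abs_self g
      _ ≤ |g| * S * n := le_mul_of_one_le_right (by positivity) hn
  have hgV : ∀ V, 0 ≤ V → V ≤ S → -(|g| * S) ≤ g * V := fun V hV hVS => by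
    have h1 : |g| * V ≤ |g| * S := by gcongr
    have h2 : -|g| * V ≤ g * V := by gcongr; exact neg_abs_le g
    linarith
  have hgX : -(|g| * S) ≤ g * X := hgV X hX hXS
  have hgZ : -(q / 2 * (|g| * S)) ≤ q / 2 * Z * g := by
    have h1 : q / 2 * -(|g| * S) ≤ q / 2 * (g * Z) := by gcongr; exact hgV Z hZ hZS
    linarith
  have hDX : -(2 * N * τ ^ 2) * S ≤ D * X := by
    have h1 : -(2 * N * τ ^ 2) * X ≤ D * X := by gcongr
    have h2 : 2 * N * τ ^ 2 * X ≤ 2 * N * τ ^ 2 * S := by gcongr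
    linarith
  have hGX : G * X ≤ 16 * τ ^ 2 * S := by
    have h1 : G * X ≤ 16 * τ ^ 2 * X := by gcongr
    have h2 : 16 * τ ^ 2 * X ≤ 16 * τ ^ 2 * S := by gcongr
    linarith
  have hfin : (1 - θ) / n * S ^ 2 ≤ (2 + q / 2) * (|g| * S) + (16 + 2 * N) * τ ^ 2 * S := by
    linarith
  have hgS' : |g| * S ≤ 4 * τ * s * S := by gcongr
  have hfin2 : (1 - θ) / n * S ^ 2 ≤ (8 + 2 * q) * τ * s * S + (16 + 2 * N) * τ ^ 2 * S := by
    have h1 : (2 + q / 2) * (|g| * S) ≤ (2 + q / 2) * (4 * τ * s * S) := by gcongr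
    linarith
  rcases hS0.eq_or_lt with h0 | hSpos
  · rw [← h0]; positivity
  have hfin3 : (1 - θ) / n * s ^ 2 ≤ (8 + 2 * q) * τ * s + (16 + 2 * N) * τ ^ 2 := by
    refine le_of_mul_le_mul_right ?_ hSpos
    rw [hsS]; linarith
  have hκ : 0 < (1 - θ) / n := div_pos (by linarith) hn0
  have := le_of_mul_sq_le hκ (by linarith) (by linarith) hτ hfin3
  rw [← hsS]
  gcongr

end Algebra

/-! ### Bernstein's gradient estimate for the logarithm. -/

section Bernstein

variable {N : ℕ}

/-- The squared norm of the gradient. -/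
noncomputable def gradSq (w : Euc N → ℝ) (x : Euc N) : ℝ := ∑ j, pd j w x ^ 2

/-- The right-hand side of the equation `-Δw = |∇w|² + e^{(p-1)w} + M e^{(q-1)w} |∇w|^q` solved by
the logarithm of a positive solution. -/
noncomputable def logSource (p q M : ℝ) (w : Euc N → ℝ) (x : Euc N) : ℝ :=
  gradSq w x + Real.exp ((p - 1) * w x) + M * (Real.exp ((q - 1) * w x) * gradSq w x ^ (q / 2))

theorem gradSq_nonneg (w : Euc N → ℝ) (x : Euc N) : 0 ≤ gradSq w x := by
  unfold gradSq; positivity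

theorem contDiffAt_gradSq {w : Euc N → ℝ} {x : Euc N} (hw : ContDiffAt ℝ 2 w x) :
    ContDiffAt ℝ 1 (gradSq w) x :=
  ContDiffAt.sum fun j _ => (hw.pd (m := 1) (by norm_num)).pow 2

/-- Positivity of `gradSq w x` is needed because `t ↦ t ^ (q/2)` need not be `C¹` at `0`; the main
theorem has `q < 2`. -/
theorem contDiffAt_logSource {p q M : ℝ} {w : Euc N → ℝ} {x : Euc N} (hw : ContDiffAt ℝ 2 w x)
    (hX : 0 < gradSq w x) : ContDiffAt ℝ 1 (logSource p q M w) x := by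
  have h1 := contDiffAt_gradSq hw
  have hw1 : ContDiffAt ℝ 1 w x := hw.of_le (by norm_num)
  exact (h1.add (contDiffAt_const.mul hw1).exp).add
    (contDiffAt_const.mul ((contDiffAt_const.mul hw1).exp.mul (h1.rpow_const_of_ne hX.ne')))

theorem pd_exp_mul {w : Euc N → ℝ} {x : Euc N} (hw : DifferentiableAt ℝ w x) (k : ℝ) (i : Fin N) :
    pd i (fun y => Real.exp (k * w y)) x = k * Real.exp (k * w x) * pd i w x := by
  have h : HasDerivAt (fun t => Real.exp (k * t)) (k * Real.exp (k * w x)) (w x) := by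
    have := ((hasDerivAt_id (w x)).const_mul k).exp
    simpa [mul_comm] using this
  exact pd_comp h hw

theorem pd_logSource {p q M : ℝ} {w : Euc N → ℝ} {x : Euc N} (hw : ContDiffAt ℝ 2 w x)
    (hX : 0 < gradSq w x) (i : Fin N) :
    pd i (logSource p q M w) x = pd i (gradSq w) x +
      (p - 1) * Real.exp ((p - 1) * w x) * pd i w x +
      ((q - 1) * (M * (Real.exp ((q - 1) * w x) * gradSq w x ^ (q / 2))) * pd i w x +
      q / 2 * (M * (Real.exp ((q - 1) * w x) * gradSq w x ^ (q / 2))) *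
        (pd i (gradSq w) x / gradSq w x)) := by
  have hwd : DifferentiableAt ℝ w x := hw.differentiableAt (by norm_num)
  have hXd : DifferentiableAt ℝ (gradSq w) x := (contDiffAt_gradSq hw).differentiableAt (by norm_num)
  have hr := Real.hasDerivAt_rpow_const (x := gradSq w x) (p := q / 2) (Or.inl hX.ne')
  have hd1 : DifferentiableAt ℝ (fun y => Real.exp ((p - 1) * w y)) x := (hwd.const_mul _).exp
  have hd2 : DifferentiableAt ℝ (fun y => Real.exp ((q - 1) * w y)) x := (hwd.const_mul _).exp
  have hd3 : DifferentiableAt ℝ (fun y => gradSq w y ^ (q / 2)) x :=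
    hXd.rpow_const (Or.inl hX.ne')
  have : pd i (logSource p q M w) x = _ :=
    pd_add (hXd.fun_add hd1) ((hd2.fun_mul hd3).const_mul M)
  rw [this, pd_add hXd hd1, pd_const_mul (hd2.fun_mul hd3), pd_mul hd2 hd3, pd_exp_mul hwd,
    pd_exp_mul hwd, pd_comp hr hXd, Real.rpow_sub_one hX.ne']
  field_simp

/-- The cut-off function `(R² - |x - x₀|²)²`. -/
noncomputable def cutoff (x₀ : Euc N) (R : ℝ) (x : Euc N) : ℝ := (R ^ 2 - ‖x - x₀‖ ^ 2) ^ 2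

theorem contDiff_cutoff (x₀ : Euc N) (R : ℝ) : ContDiff ℝ 2 (cutoff x₀ R) :=
  (contDiff_const.sub (contDiff_norm_sub_sq x₀)).pow 2

theorem pd_cutoff (x₀ : Euc N) (R : ℝ) (i : Fin N) :
    pd i (cutoff x₀ R) = fun x => -4 * ((R ^ 2 - ‖x - x₀‖ ^ 2) * (x i - x₀ i)) := by
  funext x
  have hd : DifferentiableAt ℝ (fun x => ‖x - x₀‖ ^ 2) x :=
    (contDiff_norm_sub_sq (n := 1) x₀).differentiable (by norm_num) x
  have : pd i (cutoff x₀ R) x = _ := pd_sq ((differentiableAt_const (R ^ 2)).fun_sub hd)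
  rw [this, pd_sub (differentiableAt_const _) hd, pd_const, pd_norm_sub_sq]
  ring

theorem pd_pd_cutoff (x₀ : Euc N) (R : ℝ) (i : Fin N) (x : Euc N) :
    pd i (pd i (cutoff x₀ R)) x = 8 * (x i - x₀ i) ^ 2 - 4 * (R ^ 2 - ‖x - x₀‖ ^ 2) := by
  have hd : DifferentiableAt ℝ (fun x => ‖x - x₀‖ ^ 2) x :=
    (contDiff_norm_sub_sq (n := 1) x₀).differentiable (by norm_num) x
  have hd1 : DifferentiableAt ℝ (fun x => R ^ 2 - ‖x - x₀‖ ^ 2) x :=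
    (differentiableAt_const _).fun_sub hd
  have hd2 : DifferentiableAt ℝ (fun x : Euc N => x i - x₀ i) x :=
    (differentiable_coord i x).sub_const _
  rw [pd_cutoff, pd_const_mul (hd1.fun_mul hd2), pd_mul hd1 hd2,
    pd_sub (differentiableAt_const _) hd, pd_const, pd_norm_sub_sq,
    pd_sub (differentiable_coord i x) (differentiableAt_const _), pd_coord, pd_const, if_pos rfl]
  ring

theorem sum_sub_sq (x x₀ : Euc N) : ∑ i, (x i - x₀ i) ^ 2 = ‖x - x₀‖ ^ 2 := by
  rw [EuclideanSpace.norm_sq_eq]; simp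

/-- The Bernstein constant. -/
noncomputable def bernsteinConst (N : ℕ) (q θ : ℝ) : ℝ :=
  (8 + 2 * q + (16 + 2 * N)) / ((1 - θ) / (N - 1)) + 1

/-- The critical point equation expresses `∇X` through `X ∇φ`, which removes every second derivative
of `w` from the Bochner inequality except `|D²w|²`. The equation for `Δw` and the trace inequality
then make it scalar. The whole source is bounded, not merely `gradSq`, because the good term is
quadratic in it. -/
theorem logSource_le_at_max (hN : 2 ≤ N) {p q θ M R : ℝ} {w : Euc N → ℝ} {x₀ x₁ : Euc N}
    (hp : (N - 1 : ℝ) * (p - 1) ≤ 4 * θ) (hq1 : 1 < q)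
    (hq : (N - 1 : ℝ) * (q - 1) ≤ 4 * θ) (hθ : θ < 1) (hM : 0 ≤ M) (hR : 0 < R)
    (hw : ContDiffAt ℝ 2 w x₁)
    (heq : ∀ᶠ x in 𝓝 x₁, ∑ i, pd i (pd i w) x = -logSource p q M w x)
    (hψ : 0 < R ^ 2 - ‖x₁ - x₀‖ ^ 2) (hX : 0 < gradSq w x₁)
    (hmax : IsLocalMax (fun x => cutoff x₀ R x * gradSq w x) x₁) :
    logSource p q M w x₁ ≤
      (bernsteinConst N q θ * (R / (R ^ 2 - ‖x₁ - x₀‖ ^ 2))) ^ 2 := by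
  set ψ := R ^ 2 - ‖x₁ - x₀‖ ^ 2 with hψdef
  have hφ := contDiff_cutoff x₀ R
  have hwd : ∀ j, DifferentiableAt ℝ (pd j w) x₁ := fun j =>
    (hw.pd (m := 1) (by norm_num)).differentiableAt (by norm_num)
  have hXd : DifferentiableAt ℝ (gradSq w) x₁ := (contDiffAt_gradSq hw).differentiableAt (by norm_num)
  have hS : ContDiffAt ℝ 1 (fun x => -logSource p q M w x) x₁ := (contDiffAt_logSource hw hX).neg
  have hB := weightedBochner_nonpos_of_isLocalMax hw hS hφ heq hmax
  have hφ1 : cutoff x₀ R x₁ = ψ ^ 2 := rfl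
  have hφd : DifferentiableAt ℝ (cutoff x₀ R) x₁ := hφ.differentiable (by norm_num) x₁
  have hgrad : ∀ i, pd i (gradSq w) x₁ = 2 * ∑ j, pd j w x₁ * pd i (pd j w) x₁ := fun i =>
    pd_sum_sq i hwd
  set X := gradSq w x₁ with hXdef
  have hXsum : ∑ j, pd j w x₁ ^ 2 = X := rfl
  set d : Fin N → ℝ := fun i => x₁ i - x₀ i with hd
  have hdsum : ∑ i, d i ^ 2 = ‖x₁ - x₀‖ ^ 2 := sum_sub_sq x₁ x₀
  -- This is `∇(φX) = 0` with `∇φ = -4ψ d`, divided by `ψ`. As `∇X = 2 D²w ∇w`, it also gives `D²w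
  -- ∇w` below.
  have hXi : ∀ i, pd i (gradSq w) x₁ = 4 * d i * X / ψ := fun i => by
    have h := hmax.pd_eq_zero (i := i)
    rw [pd_mul hφd hXd, pd_cutoff, hφ1] at h
    field_simp
    have h' : ψ * (pd i (gradSq w) x₁ * ψ - 4 * d i * X) = 0 := by linear_combination h
    have := (mul_eq_zero.1 h').resolve_left hψ.ne'
    linarith
  have hHi : ∀ i, ∑ j, pd j w x₁ * pd i (pd j w) x₁ = 2 * d i * X / ψ := fun i => by
    have h1 := hgrad i
    rw [hXi] at h1
    linear_combination (-1 / 2) * h1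
  set Φ := ∑ i, d i * pd i w x₁ with hΦ
  set Y := Real.exp ((p - 1) * w x₁) with hY
  set Z := M * (Real.exp ((q - 1) * w x₁) * X ^ (q / 2)) with hZ
  have hZ0 : 0 ≤ Z := by positivity
  have hSi : ∀ j, pd j (fun x => -logSource p q M w x) x₁ =
      -(4 * d j * X / ψ + (p - 1) * Y * pd j w x₁ +
        ((q - 1) * Z * pd j w x₁ + q / 2 * Z * (4 * d j / ψ))) := fun j => by
    have : 4 * d j * X / ψ / X = 4 * d j / ψ := by field_simp
    rw [pd_neg, pd_logSource hw hX, hXi, ← hXdef, this]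
  have hwS : ∑ j, pd j w x₁ * pd j (fun x => -logSource p q M w x) x₁ =
      -(4 * X / ψ * Φ + (p - 1) * Y * X + ((q - 1) * Z * X + q / 2 * Z * (4 / ψ) * Φ)) := by
    simp only [hSi]
    have e : ∀ j, pd j w x₁ * -(4 * d j * X / ψ + (p - 1) * Y * pd j w x₁ +
        ((q - 1) * Z * pd j w x₁ + q / 2 * Z * (4 * d j / ψ))) =
        -((4 * X / ψ + q / 2 * Z * (4 / ψ)) * (d j * pd j w x₁)) -
          ((p - 1) * Y + (q - 1) * Z) * pd j w x₁ ^ 2 := fun j => by ring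
    simp only [e, Finset.sum_sub_distrib, Finset.sum_neg_distrib, ← Finset.mul_sum, hXsum]
    ring
  have hA : ∑ i, pd i w x₁ * ∑ j, pd j w x₁ * pd i (pd j w) x₁ =
      (2 * Φ / ψ) * ∑ i, pd i w x₁ ^ 2 := by
    simp only [hHi]
    have e : ∀ i, pd i w x₁ * (2 * d i * X / ψ) = 2 * X / ψ * (d i * pd i w x₁) := fun i => by ring
    simp only [e, ← Finset.mul_sum, hXsum]
    ring
  have hH := sq_add_sq_le_sum_sq hN (fun i j => pd i (pd j w) x₁) (fun i => pd i w x₁) _ hX hA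
  set h := ∑ i, ∑ j, pd i (pd j w) x₁ ^ 2 with hh
  rw [heq.self_of_nhds] at hH
  have hBsum : weightedBochner (cutoff x₀ R) w
      (fun j => pd j (fun x => -logSource p q M w x) x₁) x₁ =
      (8 * ‖x₁ - x₀‖ ^ 2 - N * (4 * ψ)) * X - 32 * ‖x₁ - x₀‖ ^ 2 * X + 2 * (ψ ^ 2 * h) +
        2 * (ψ ^ 2 * -(4 * X / ψ * Φ + (p - 1) * Y * X +
          ((q - 1) * Z * X + q / 2 * Z * (4 / ψ) * Φ))) := by
    rw [weightedBochner, hwS, hφ1]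
    have e : ∀ i, pd i (pd i (cutoff x₀ R)) x₁ * ∑ j, pd j w x₁ ^ 2 +
        4 * (pd i (cutoff x₀ R) x₁ * ∑ j, pd j w x₁ * pd i (pd j w) x₁) +
        2 * (ψ ^ 2 * ∑ j, pd i (pd j w) x₁ ^ 2) =
        -24 * X * d i ^ 2 - 4 * ψ * X + 2 * (ψ ^ 2 * ∑ j, pd i (pd j w) x₁ ^ 2) := fun i => by
      rw [pd_pd_cutoff, pd_cutoff, hXsum, hHi, ← hψdef]
      change (8 * d i ^ 2 - 4 * ψ) * X + 4 * (-4 * (ψ * d i) * (2 * d i * X / ψ)) + _ = _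
      field_simp
      ring
    simp only [e, Finset.sum_add_distrib, Finset.sum_sub_distrib, ← Finset.mul_sum, hdsum]
    simp only [Finset.sum_const, Finset.card_univ, Fintype.card_fin, nsmul_eq_mul]
    ring
  rw [hBsum] at hB
  have hψR : ψ ≤ R ^ 2 := by rw [hψdef]; nlinarith [sq_nonneg ‖x₁ - x₀‖]
  have hρR : ‖x₁ - x₀‖ ^ 2 ≤ R ^ 2 := by linarith
  have hN2 : (2 : ℝ) ≤ N := by exact_mod_cast hN
  have hCS : Φ ^ 2 ≤ ‖x₁ - x₀‖ ^ 2 * X := by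
    rw [← hdsum, ← hXsum]; exact Finset.sum_mul_sq_le_sq_mul_sq _ _ _
  have hτ : (R / ψ) ^ 2 = R ^ 2 / ψ ^ 2 := div_pow _ _ _
  -- The part `4|x₁ - x₀|²/ψ²` of `Δφ/(2φ)` is grouped with `G`, leaving only `-2N/ψ` in `D`.
  refine bernstein_scalar (n := N - 1) (N := N) (p := p) (X := X) (Y := Y) (Z := Z) (h := h)
    (a := 2 * Φ / ψ) (g := -4 * Φ / ψ) (D := -(2 * N) / ψ) (G := 16 * ‖x₁ - x₀‖ ^ 2 / ψ ^ 2 -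
      4 * ‖x₁ - x₀‖ ^ 2 / ψ ^ 2)
    (by linarith) (by positivity) hp hq1 hq hθ hX.le (Real.exp_pos _).le hZ0 rfl (by ring)
    (by positivity) ?_ ?_ ?_ hH ?_
  · rw [hτ, div_pow, mul_div_assoc', div_mul_eq_mul_div]
    gcongr
    linarith [mul_le_mul_of_nonneg_right hρR hX.le]
  · rw [hτ, neg_div, neg_le_neg_iff, mul_div_assoc', div_le_div_iff₀ hψ (by positivity)]
    have h1 : ψ * ψ ≤ R ^ 2 * ψ := by gcongr
    have h2 : 2 * (N : ℝ) * (ψ * ψ) ≤ 2 * N * (R ^ 2 * ψ) := by gcongr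
    linarith
  · rw [hτ, ← sub_div, mul_div_assoc']
    gcongr
    linarith [sq_nonneg ‖x₁ - x₀‖]
  · have h2 : 0 < 2 * ψ ^ 2 := by positivity
    refine nonpos_of_mul_nonpos_right ?_ h2
    refine le_of_eq_of_le ?_ hB
    field_simp
    ring

/-- Interior estimate for the gradient of the logarithm of a positive solution. -/
theorem cutoff_mul_gradSq_le (hN : 2 ≤ N) {p q θ M R : ℝ} {w : Euc N → ℝ} {x₀ : Euc N}
    {U : Set (Euc N)}
    (hp : (N - 1 : ℝ) * (p - 1) ≤ 4 * θ) (hq1 : 1 < q)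
    (hq : (N - 1 : ℝ) * (q - 1) ≤ 4 * θ) (hθ : θ < 1) (hM : 0 ≤ M) (hR : 0 < R)
    (hU : IsOpen U) (hRU : Metric.closedBall x₀ R ⊆ U) (hw : ContDiffOn ℝ 2 w U)
    (heq : ∀ x ∈ U, ∑ i, pd i (pd i w) x = -logSource p q M w x) {x : Euc N}
    (hx : x ∈ Metric.closedBall x₀ R) :
    cutoff x₀ R x * gradSq w x ≤ (bernsteinConst N q θ * R) ^ 2 := by
  have hwat : ∀ y ∈ U, ContDiffAt ℝ 2 w y := fun y hy => hw.contDiffAt (hU.mem_nhds hy)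
  have hc : ContinuousOn (fun y => cutoff x₀ R y * gradSq w y) (Metric.closedBall x₀ R) :=
    (contDiff_cutoff x₀ R).continuous.continuousOn.mul fun y hy =>
      (contDiffAt_gradSq (hwat y (hRU hy))).continuousAt.continuousWithinAt
  obtain ⟨x₁, hx₁, hmax⟩ := (isCompact_closedBall x₀ R).exists_isMaxOn ⟨x, hx⟩ hc
  refine (hmax hx).trans ?_
  change cutoff x₀ R x₁ * gradSq w x₁ ≤ _
  -- A positive maximum forces both factors to be positive: the point is then inside the ball and
  -- the gradient does not vanish there, as `logSource_le_at_max` requires.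
  by_cases hpos : 0 < cutoff x₀ R x₁ * gradSq w x₁
  swap
  · exact (not_lt.1 hpos).trans (sq_nonneg _)
  have hX : 0 < gradSq w x₁ := pos_of_mul_pos_right hpos (sq_nonneg _)
  have hφ : 0 < cutoff x₀ R x₁ := pos_of_mul_pos_left hpos hX.le
  have hle : ‖x₁ - x₀‖ ≤ R := by simpa [dist_eq_norm] using hx₁
  have hne : ‖x₁ - x₀‖ ≠ R := fun h => by simp [cutoff, h] at hφ
  have hlt : ‖x₁ - x₀‖ < R := lt_of_le_of_ne hle hne
  have hψ : 0 < R ^ 2 - ‖x₁ - x₀‖ ^ 2 := by nlinarith [norm_nonneg (x₁ - x₀)]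
  have hball : x₁ ∈ Metric.ball x₀ R := by simpa [dist_eq_norm] using hlt
  have hloc : IsLocalMax (fun y => cutoff x₀ R y * gradSq w y) x₁ :=
    hmax.isLocalMax (mem_of_superset (Metric.isOpen_ball.mem_nhds hball)
      Metric.ball_subset_closedBall)
  have hS := logSource_le_at_max hN hp hq1 hq hθ hM hR (hwat x₁ (hRU hx₁))
    (mem_of_superset (hU.mem_nhds (hRU hx₁)) heq) hψ hX hloc
  have hXS : gradSq w x₁ ≤ logSource p q M w x₁ := by
    have h1 := Real.exp_pos ((p - 1) * w x₁)
    have h2 : 0 ≤ M * (Real.exp ((q - 1) * w x₁) * gradSq w x₁ ^ (q / 2)) := by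
      have := Real.rpow_nonneg hX.le (q / 2)
      positivity
    unfold logSource
    linarith
  calc cutoff x₀ R x₁ * gradSq w x₁
      ≤ cutoff x₀ R x₁ * (bernsteinConst N q θ * (R / (R ^ 2 - ‖x₁ - x₀‖ ^ 2))) ^ 2 := by
        gcongr; exact hXS.trans hS
    _ = (bernsteinConst N q θ * R) ^ 2 := by
        unfold cutoff; field_simp

end Bernstein

/-! ### From the gradient bound to the universal interior estimate. -/

section UniversalEstimate

variable {N : ℕ}

theorem norm_fderiv_sq (f : Euc N → ℝ) (x : Euc N) : ‖fderiv ℝ f x‖ ^ 2 = gradSq f x := by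
  rw [gradSq, ← norm_gradient_sq, gradient, LinearIsometryEquiv.norm_map]

theorem bernsteinConst_pos {q θ : ℝ} (hN : 2 ≤ N) (hq : 1 < q) (hθ : θ < 1) :
    0 < bernsteinConst N q θ := by
  have h : (0 : ℝ) < N - 1 := by
    have : (2 : ℝ) ≤ N := by exact_mod_cast hN
    linarith
  have h2 : 0 < (1 - θ) / ((N : ℝ) - 1) := div_pos (by linarith) h
  unfold bernsteinConst
  positivity

/-- Interior estimate for the logarithm of a positive solution. -/
theorem exp_le_of_logSource (hN : 2 ≤ N) {p q θ M R : ℝ} {w : Euc N → ℝ} {x₀ : Euc N}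
    {U : Set (Euc N)} (hp1 : 1 < p)
    (hp : (N - 1 : ℝ) * (p - 1) ≤ 4 * θ) (hq1 : 1 < q)
    (hq : (N - 1 : ℝ) * (q - 1) ≤ 4 * θ) (hθ : θ < 1) (hM : 0 ≤ M) (hR : 0 < R)
    (hU : IsOpen U) (hRU : Metric.closedBall x₀ R ⊆ U) (hw : ContDiffOn ℝ 2 w U)
    (heq : ∀ x ∈ U, ∑ i, pd i (pd i w) x = -logSource p q M w x) :
    Real.exp ((p - 1) * w x₀) ≤
      Real.exp ((p - 1) * bernsteinConst N q θ) * (16 * N * bernsteinConst N q θ) / R ^ 2 := by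
  set K := bernsteinConst N q θ with hK
  have hK0 : 0 < K := bernsteinConst_pos hN hq1 hθ
  have hwat : ∀ y ∈ U, ContDiffAt ℝ 2 w y := fun y hy => hw.contDiffAt (hU.mem_nhds hy)
  have hsub : Metric.closedBall x₀ (R / 2) ⊆ Metric.closedBall x₀ R :=
    Metric.closedBall_subset_closedBall (by linarith)
  have hx₀ : x₀ ∈ Metric.closedBall x₀ (R / 2) := Metric.mem_closedBall_self (by positivity)
  have hgrad : ∀ x ∈ Metric.closedBall x₀ (R / 2), ‖fderiv ℝ w x‖ ≤ 2 * K / R := fun x hx => by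
    have h := cutoff_mul_gradSq_le hN hp hq1 hq hθ hM hR hU hRU hw heq (hsub hx)
    have hd : ‖x - x₀‖ ≤ R / 2 := by simpa [dist_eq_norm] using hx
    have hd2 : ‖x - x₀‖ ^ 2 ≤ (R / 2) ^ 2 := by gcongr
    have hc : (R ^ 2 / 2) ^ 2 ≤ cutoff x₀ R x := by
      unfold cutoff; gcongr; nlinarith
    have h2 : (R ^ 2 / 2) ^ 2 * gradSq w x ≤ (K * R) ^ 2 :=
      (mul_le_mul_of_nonneg_right hc (gradSq_nonneg w x)).trans h
    refine le_of_sq_le_sq ?_ (by positivity)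
    rw [norm_fderiv_sq, div_pow, le_div_iff₀ (by positivity)]
    refine le_of_mul_le_mul_left ?_ (by positivity : 0 < R ^ 2)
    linarith
  have hosc : ∀ x ∈ Metric.closedBall x₀ (R / 2), w x₀ - K ≤ w x := fun x hx => by
    have h := (convex_closedBall x₀ (R / 2)).norm_image_sub_le_of_norm_fderiv_le (𝕜 := ℝ)
      (fun y hy => (hwat y (hRU (hsub hy))).differentiableAt (by norm_num)) hgrad hx₀ hx
    have hd : ‖x - x₀‖ ≤ R / 2 := by simpa [dist_eq_norm] using hx
    have h2 : 2 * K / R * ‖x - x₀‖ ≤ 2 * K / R * (R / 2) := by gcongr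
    have h3 : 2 * K / R * (R / 2) = K := by field_simp
    rw [Real.norm_eq_abs] at h
    linarith [(abs_le.1 h).1]
  -- On the sphere of radius `R / 2` the paraboloid has dropped by `A (R/2)² = 2K`, more than the
  -- possible decrease `K` of `w`. The contact point is therefore interior.
  set A := 8 * K / R ^ 2 with hA
  have hc : ContinuousOn (fun y => -A * ‖y - x₀‖ ^ 2 - w y) (Metric.closedBall x₀ (R / 2)) :=
    (Continuous.continuousOn (by fun_prop)).sub fun y hy =>
      (hwat y (hRU (hsub hy))).continuousAt.continuousWithinAt
  obtain ⟨z, hz, hmax⟩ := (isCompact_closedBall x₀ (R / 2)).exists_isMaxOn ⟨x₀, hx₀⟩ hc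
  have hz0 := hmax hx₀
  simp only [Set.mem_ofPred_eq, sub_self, norm_zero] at hz0
  have hle : ‖z - x₀‖ ≤ R / 2 := by simpa [dist_eq_norm] using hz
  have hlt : ‖z - x₀‖ < R / 2 := by
    refine lt_of_le_of_ne hle fun h => ?_
    have h1 : A * (R / 2) ^ 2 = 2 * K := by rw [hA]; field_simp; norm_num
    rw [h] at hz0
    linarith [hosc z hz]
  have hball : z ∈ Metric.ball x₀ (R / 2) := by simpa [dist_eq_norm] using hlt
  have hzU : z ∈ U := hRU (hsub hz)
  have hloc : IsLocalMax (fun y => -A * ‖y - x₀‖ ^ 2 - w y) z :=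
    hmax.isLocalMax (mem_of_superset (Metric.isOpen_ball.mem_nhds hball)
      Metric.ball_subset_closedBall)
  have hq2 : ContDiffAt ℝ 2 (fun y => -A * ‖y - x₀‖ ^ 2) z :=
    (contDiff_const.mul (contDiff_norm_sub_sq x₀)).contDiffAt
  have hS : logSource p q M w z ≤ N * (2 * A) := by
    have h : ∀ i, -(2 * A) ≤ pd i (pd i w) z := fun i => by
      have := hloc.pd_pd_nonpos (hq2.sub (hwat z hzU)) i
      rw [pd_pd_sub hq2 (hwat z hzU), pd_pd_mul_norm_sub_sq] at this
      linarith
    have h2 := Finset.sum_le_sum fun i (_ : i ∈ Finset.univ) => h i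
    rw [heq z hzU] at h2
    simp only [Finset.sum_const, Finset.card_univ, Fintype.card_fin, nsmul_eq_mul] at h2
    linarith
  have hYS : Real.exp ((p - 1) * w z) ≤ logSource p q M w z := by
    have h1 := gradSq_nonneg w z
    have h2 : 0 ≤ M * (Real.exp ((q - 1) * w z) * gradSq w z ^ (q / 2)) := by
      have := Real.rpow_nonneg h1 (q / 2)
      positivity
    unfold logSource
    linarith
  calc Real.exp ((p - 1) * w x₀) ≤ Real.exp ((p - 1) * K + (p - 1) * w z) := by
        refine Real.exp_le_exp.2 ?_
        rw [← mul_add]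
        exact mul_le_mul_of_nonneg_left (by linarith [hosc z hz]) (by linarith)
    _ = Real.exp ((p - 1) * K) * Real.exp ((p - 1) * w z) := Real.exp_add _ _
    _ ≤ Real.exp ((p - 1) * K) * (N * (2 * A)) := by gcongr; exact hYS.trans hS
    _ = _ := by rw [hA]; ring

theorem pd_log {u : Euc N → ℝ} {x : Euc N} (hu : DifferentiableAt ℝ u x) (hx : 0 < u x)
    (i : Fin N) : pd i (fun y => Real.log (u y)) x = (u x)⁻¹ * pd i u x :=
  pd_comp (Real.hasDerivAt_log hx.ne') hu

theorem gradSq_log {u : Euc N → ℝ} {x : Euc N} (hu : DifferentiableAt ℝ u x) (hx : 0 < u x) :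
    gradSq (fun y => Real.log (u y)) x = (‖gradient u x‖ / u x) ^ 2 := by
  rw [div_pow, norm_gradient_sq, gradSq, Finset.sum_div]
  refine Finset.sum_congr rfl fun i _ => ?_
  rw [pd_log hu hx]; field_simp

/-- The equation solved by the logarithm of a positive solution. -/
theorem IsPositiveSolution.sum_pd_pd_log {Ω : Set (Euc N)} {p q M : ℝ} {u : Euc N → ℝ}
    (hΩ : IsOpen Ω) (hu : IsPositiveSolution Ω p q M u) {x : Euc N} (hx : x ∈ Ω) :
    ∑ i, pd i (pd i fun y => Real.log (u y)) x =
      -logSource p q M (fun y => Real.log (u y)) x := by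
  have hat : ∀ y ∈ Ω, ContDiffAt ℝ 2 u y := fun y hy => hu.contDiffOn.contDiffAt (hΩ.mem_nhds hy)
  have hd : ∀ y ∈ Ω, DifferentiableAt ℝ u y := fun y hy => (hat y hy).differentiableAt (by norm_num)
  have hpos := hu.pos x hx
  have h2 : ∀ i, pd i (pd i fun y => Real.log (u y)) x =
      (u x)⁻¹ * pd i (pd i u) x - pd i (fun y => Real.log (u y)) x ^ 2 := fun i => by
    have h : pd i (fun y => Real.log (u y)) =ᶠ[𝓝 x] fun y => (u y)⁻¹ * pd i u y := by
      filter_upwards [hΩ.mem_nhds hx] with y hy using pd_log (hd y hy) (hu.pos y hy) i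
    have hpd : DifferentiableAt ℝ (pd i u) x :=
      ((hat x hx).pd (m := 1) (by norm_num)).differentiableAt (by norm_num)
    rw [pd_congr h, pd_mul ((hd x hx).fun_inv hpos.ne') hpd, pd_log (hd x hx) hpos,
      pd_comp (hasDerivAt_inv hpos.ne') (hd x hx)]
    field_simp
    ring
  have hsum : ∑ i, pd i (fun y => Real.log (u y)) x ^ 2 =
    gradSq (fun y => Real.log (u y)) x := rfl
  have heq := hu.eqn x hx
  rw [laplacian_eq_sum_pd (hat x hx), abs_of_pos hpos] at heq
  have hX := gradSq_log (hd x hx) hpos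
  have hY : Real.exp ((p - 1) * Real.log (u x)) = u x ^ (p - 1) := by
    rw [Real.rpow_def_of_pos hpos, mul_comm]
  have hZ : Real.exp ((q - 1) * Real.log (u x)) *
      gradSq (fun y => Real.log (u y)) x ^ (q / 2) = (u x)⁻¹ * ‖gradient u x‖ ^ q := by
    rw [hX, ← Real.rpow_natCast, ← Real.rpow_mul (by positivity), mul_comm (q - 1),
      ← Real.rpow_def_of_pos hpos, Real.rpow_sub_one hpos.ne']
    have : ((2 : ℕ) : ℝ) * (q / 2) = q := by push_cast; ring
    rw [this, Real.div_rpow (norm_nonneg _) hpos.le]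
    have := (Real.rpow_pos_of_pos hpos q).ne'
    field_simp
  simp only [h2, Finset.sum_sub_distrib, ← Finset.mul_sum, logSource, hsum]
  rw [hY, hZ, neg_eq_iff_eq_neg.1 heq]
  field_simp
  ring

/-- The universal interior estimate for positive solutions. -/
theorem exists_universal_bound (hN : 2 ≤ N) {p q : ℝ} (hp1 : 1 < p)
    (hp : p < ((N : ℝ) + 3) / ((N : ℝ) - 1)) (hq1 : 1 < q) (hq : q < ((N : ℝ) + 2) / (N : ℝ)) :
    ∃ c : ℝ, 0 < c ∧ ∀ Ω : Set (Euc N), IsOpen Ω → ∀ M : ℝ, 0 < M → ∀ u : Euc N → ℝ,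
      IsPositiveSolution Ω p q M u → ∀ x₀ R, 0 < R → Metric.closedBall x₀ (R / 2) ⊆ Ω →
        u x₀ ≤ c * R ^ (-(2 / (p - 1))) := by
  have hN2 : (2 : ℝ) ≤ N := by exact_mod_cast hN
  have hn : (0 : ℝ) < N - 1 := by linarith
  -- The bound on `p` says `(N-1)(p-1) < 4`, and that on `q` gives `(N-1)(q-1) < 2`; so a quarter of
  -- the larger product is a `θ < 1`.
  obtain ⟨θ, hθ1, hθp, hθq⟩ : ∃ θ : ℝ, θ < 1 ∧ ((N : ℝ) - 1) * (p - 1) ≤ 4 * θ ∧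
      ((N : ℝ) - 1) * (q - 1) ≤ 4 * θ := by
    refine ⟨max (((N : ℝ) - 1) * (p - 1)) (((N : ℝ) - 1) * (q - 1)) / 4, ?_, ?_, ?_⟩
    · rw [div_lt_one (by norm_num), max_lt_iff]
      rw [lt_div_iff₀ hn] at hp
      rw [lt_div_iff₀ (by linarith)] at hq
      constructor <;> nlinarith
    · linarith [le_max_left (((N : ℝ) - 1) * (p - 1)) (((N : ℝ) - 1) * (q - 1))]
    · linarith [le_max_right (((N : ℝ) - 1) * (p - 1)) (((N : ℝ) - 1) * (q - 1))]
  have hK0 : 0 < bernsteinConst N q θ := bernsteinConst_pos hN hq1 hθ1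
  -- The factor `4` compensates for applying the interior estimate at radius `R / 2`.
  set C := 4 * (Real.exp ((p - 1) * bernsteinConst N q θ) * (16 * N * bernsteinConst N q θ))
    with hC
  have hC0 : 0 < C := by positivity
  refine ⟨C ^ (1 / (p - 1)), by positivity, fun Ω hΩ M hM u hu x₀ R hR hball => ?_⟩
  have hx₀ : x₀ ∈ Ω := hball (Metric.mem_closedBall_self (by positivity))
  have hpos := hu.pos x₀ hx₀
  have hw : ContDiffOn ℝ 2 (fun y => Real.log (u y)) Ω :=
    hu.contDiffOn.log fun y hy => (hu.pos y hy).ne'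
  have h := exp_le_of_logSource hN hp1 hθp hq1 hθq hθ1 hM.le (half_pos hR) hΩ hball hw
    fun y hy => hu.sum_pd_pd_log hΩ hy
  rw [mul_comm (p - 1) (Real.log (u x₀)), ← Real.rpow_def_of_pos hpos] at h
  have h2 : u x₀ ^ (p - 1) ≤ C / R ^ 2 := h.trans_eq (by rw [hC]; field_simp; norm_num)
  have hp0 : 0 < p - 1 := by linarith
  calc u x₀ = (u x₀ ^ (p - 1)) ^ (1 / (p - 1)) := by
        rw [← Real.rpow_mul hpos.le, mul_one_div_cancel hp0.ne', Real.rpow_one]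
    _ ≤ (C / R ^ 2) ^ (1 / (p - 1)) := by gcongr
    _ = C ^ (1 / (p - 1)) * R ^ (-(2 / (p - 1))) := by
        rw [Real.div_rpow hC0.le (by positivity), div_eq_mul_inv, ← Real.rpow_natCast,
          ← Real.rpow_mul hR.le, ← Real.rpow_neg hR.le]
        congr 3
        push_cast
        ring

end UniversalEstimate

/-! ### Level sets of the distance to the boundary. -/

section LevelSets

open Metric

variable {E : Type*} [NormedAddCommGroup E] {Ω : Set E}

theorem infDist_frontier_pos (hΩ : IsOpen Ω) (hne : (frontier Ω).Nonempty) {x : E} (hx : x ∈ Ω) :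
    0 < infDist x (frontier Ω) := by
  refine (isClosed_frontier.notMem_iff_infDist_pos hne).1 fun h => ?_
  rw [hΩ.frontier_eq] at h
  exact h.2 hx

/-- The ball is connected, meets `Ω` and misses the frontier, so it cannot reach the complement of
the closure. -/
theorem ball_infDist_frontier_subset [NormedSpace ℝ E] (hΩ : IsOpen Ω) (hne : (frontier Ω).Nonempty) {x : E}
    (hx : x ∈ Ω) : ball x (infDist x (frontier Ω)) ⊆ Ω := by
  have hpre : IsPreconnected (ball x (infDist x (frontier Ω))) := (convex_ball _ _).isPreconnected
  refine hpre.subset_left_of_subset_union hΩ (isClosed_closure (s := Ω)).isOpen_compl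
    (Set.disjoint_left.2 fun y hy hy' => hy' (subset_closure hy)) (fun y hy => ?_)
    ⟨x, mem_ball_self (infDist_frontier_pos hΩ hne hx), hx⟩
  by_contra h
  simp only [Set.mem_union, Set.mem_compl_iff, not_or, not_not] at h
  have : y ∈ frontier Ω := by
    rw [hΩ.frontier_eq]; exact ⟨h.2, h.1⟩
  exact ball_infDist_subset_compl hy this

/-- As `d > 0`, the level set avoids the frontier, so `Ω` may be replaced by its closure, which
gives closedness. Its points lie within `d` of the bounded frontier, even if `Ω` is unbounded. -/
theorem isCompact_infDist_frontier_eq [ProperSpace E] (hΩ : IsOpen Ω)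
    (hb : Bornology.IsBounded (frontier Ω)) (hne : (frontier Ω).Nonempty) {d : ℝ} (hd : 0 < d) :
    IsCompact {z | z ∈ Ω ∧ infDist z (frontier Ω) = d} := by
  have heq : {z | z ∈ Ω ∧ infDist z (frontier Ω) = d} =
      closure Ω ∩ {z | infDist z (frontier Ω) = d} := by
    ext z
    refine ⟨fun h => ⟨subset_closure h.1, h.2⟩, fun h => ⟨?_, h.2⟩⟩
    by_contra hz
    have hzf : z ∈ frontier Ω := by
      rw [hΩ.frontier_eq]; exact ⟨h.1, hz⟩
    have h2 : infDist z (frontier Ω) = d := h.2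
    rw [infDist_zero_of_mem hzf] at h2
    exact hd.ne h2
  refine isCompact_of_isClosed_isBounded ?_ ?_
  · rw [heq]
    exact isClosed_closure.inter (isClosed_eq (continuous_infDist_pt _) continuous_const)
  · refine (hb.cthickening (δ := d)).subset fun z hz => ?_
    obtain ⟨y, hy, hyd⟩ := isClosed_frontier.exists_infDist_eq_dist hne z
    exact mem_cthickening_of_dist_le z y d _ hy (hyd ▸ hz.2.le)

end LevelSets

/-! ### The main theorem. -/

theorem corollary3p1 (N : ℕ) (hN : 2 ≤ N) :
    ∃ d₀ : Set (EuclideanSpace ℝ (Fin N)) → ℝ,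
      (∀ Ω : Set (EuclideanSpace ℝ (Fin N)), IsSmoothDomain Ω →
        Bornology.IsBounded (frontier Ω) → (frontier Ω).Nonempty → 0 < d₀ Ω) ∧
      ∀ p q : ℝ, 1 < p → p < ((N : ℝ) + 3) / ((N : ℝ) - 1) →
        1 < q → q < ((N : ℝ) + 2) / (N : ℝ) →
        ∃ c : ℝ, 0 < c ∧
          ∀ Ω : Set (EuclideanSpace ℝ (Fin N)), IsSmoothDomain Ω →
            Bornology.IsBounded (frontier Ω) → (frontier Ω).Nonempty →
            ∀ M : ℝ, 0 < M → ∀ u : EuclideanSpace ℝ (Fin N) → ℝ,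
              IsPositiveSolution Ω p q M u →
              ∃ m : ℝ,
                IsGreatest (u '' {z | z ∈ Ω ∧ Metric.infDist z (frontier Ω) = d₀ Ω}) m ∧
                ∀ x ∈ Ω, u x ≤ c * (Metric.infDist x (frontier Ω) ^ (-(2 / (p - 1))) + m) := by
  -- Any attained value of the distance serves as `d₀`; it is positive because the points of `Ω` are
  -- off the closed frontier.
  have hex : ∀ Ω : Set (EuclideanSpace ℝ (Fin N)), ∃ d : ℝ, Ω.Nonempty →
      ∃ z ∈ Ω, Metric.infDist z (frontier Ω) = d := fun Ω => by
    by_cases h : Ω.Nonempty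
    · obtain ⟨z, hz⟩ := h
      exact ⟨_, fun _ => ⟨z, hz, rfl⟩⟩
    · exact ⟨0, fun h' => absurd h' h⟩
  choose d₀ hd₀ using hex
  have hpos : ∀ Ω : Set (EuclideanSpace ℝ (Fin N)), IsSmoothDomain Ω →
      (frontier Ω).Nonempty → 0 < d₀ Ω := fun Ω hΩ hne => by
    obtain ⟨z, hz, hzd⟩ := hd₀ Ω hΩ.isConnected.nonempty
    exact hzd ▸ infDist_frontier_pos hΩ.isOpen hne hz
  refine ⟨d₀, fun Ω hΩ _ hne => hpos Ω hΩ hne, fun p q hp1 hp hq1 hq => ?_⟩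
  obtain ⟨c, hc, hbound⟩ := exists_universal_bound hN hp1 hp hq1 hq
  refine ⟨c, hc, fun Ω hΩ hb hne M hM u hu => ?_⟩
  have hcomp := isCompact_infDist_frontier_eq hΩ.isOpen hb hne (hpos Ω hΩ hne)
  have hcont : ContinuousOn u {z | z ∈ Ω ∧ Metric.infDist z (frontier Ω) = d₀ Ω} :=
    hu.contDiffOn.continuousOn.mono fun z hz => hz.1
  obtain ⟨z, hz, hzd⟩ := hd₀ Ω hΩ.isConnected.nonempty
  obtain ⟨m, hm⟩ := (hcomp.image_of_continuousOn hcont).exists_isGreatest ⟨u z, z, ⟨hz, hzd⟩, rfl⟩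
  refine ⟨m, hm, fun x hx => ?_⟩
  have hm0 : 0 < m := (hu.pos z hz).trans_le (hm.2 ⟨z, ⟨hz, hzd⟩, rfl⟩)
  have hd := infDist_frontier_pos hΩ.isOpen hne hx
  have hball : Metric.closedBall x (Metric.infDist x (frontier Ω) / 2) ⊆ Ω :=
    (Metric.closedBall_subset_ball (by linarith)).trans
      (ball_infDist_frontier_subset hΩ.isOpen hne hx)
  -- The universal bound already suffices; `m` enters only through `m > 0`.
  calc u x ≤ c * Metric.infDist x (frontier Ω) ^ (-(2 / (p - 1))) :=
        hbound Ω hΩ.isOpen M hM u hu x _ hd hball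
    _ ≤ c * (Metric.infDist x (frontier Ω) ^ (-(2 / (p - 1))) + m) := by
        gcongr; linarith
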